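/- Let $d\in\mathbb N\cup\{\infty\}$ and let $\mathbb B^d$ be the open unit ball of $\mathbb C^d$ (of $\ell^2(\mathbb N)$ if $d=\infty$), with $zw^*=\sum_n z_n\overline{w_n}$. For a reproducing kernel Hilbert space $\mathcal H$ of complex functions on a set $X$, $\mathrm{Mult}(\mathcal H)$ denotes the algebra of functions $\varphi:X\to\mathbb C$ for which $f\mapsto\varphi f$ is a bounded operator on $\mathcal H$; a multiplier $a\in \mathrm{Mult}(\mathcal H)$ is called outer for $\mathcal H$ if $a\mathcal H$ is dense in $\mathcal H$; and a column $(c_j)_j$ of functions is called a contractive multiplier if $f\mapsto (c_jf)_j$ is a contraction from $\mathcal H$ into $\bigoplus_j\mathcal H$. Let $\Omega$ be a set, let $u:\Omega\to\mathbb B^d$ be any function, and let $\mathcal H(k)$ be the reproducing kernel Hilbert space on $\Omega$ whose kernel is the normalized complete Nevanlinna–Pick kernel $$k(x,y)=\frac1{1-u(x)u(y)^*}.$$ (1) If $(h_i)_{i\ge1}$ is a sequence in $\mathcal H(k)$ with $\sum_i\|h_i\|^2<\infty$, then there exist $a,b_1,b_2,\dots\in\mathrm{Mult}(\mathcal H(k))$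 such that (i) $a$ is outer for $\mathcal H(k)$; (ii) $a$ has no zeros in $\Omega$ and $h_i=b_i/a$ on $\Omega$ for each $i$; (iii) the column $(a,b_1,b_2,\dots)^{T}$ is a contractive multiplier of $\mathcal H(k)$; (iv) $1/a\in\mathcal H(k)$ and $\|1/a\|^2_{\mathcal H(k)}\le 1+\sum_{i=1}^\infty\|h_i\|^2_{\mathcal H(k)}$. (2) Let $H^2_d$ be the Drury–Arveson space, i.e. the reproducing kernel Hilbert space on $\mathbb B^d$ with kernel $(1-zw^*)^{-1}$. Put $E=u(\Omega)$ and let $\mathcal H_E$ be the closed linear span in $H^2_d$ of the kernel functions $(1-zw^*)^{-1}$, $w\in E$, regarded as a space of functions on $E$ by restriction, with the norm of $H^2_d$. If $a\in\mathrm{Mult}(H^2_d)$ is outer for $H^2_d$, then $a|_E\in\mathrm{Mult}(\mathcal H_E)$ and $a|_E$ is outer for $\mathcal H_E$. -/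

import Mathlib

open scoped InnerProductSpace lp ComplexConjugate

/-- The open unit ball `𝔹^d` of `ℂ^d` for finite `d`, and of `ℓ²(ℕ)` for `d = ∞`: the coordinates
are indexed by the natural numbers `n < d`. -/
abbrev UnitBall (d : ℕ∞) : Type :=
  Metric.ball (0 : ℓ²({n : ℕ // (n : ℕ∞) < d}, ℂ)) 1

/-- The normalized complete Nevanlinna-Pick kernel `k(x, y) = 1 / (1 - u(x) u(y)^*)` of a map
`u : Ω → 𝔹^d`. (Mathlib's inner product is conjugate-linear in the first variable, so
`u(x) u(y)^* = ∑ₙ uₙ(x) * conj uₙ(y)` is `⟪u y, u x⟫_ℂ`.) -/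
noncomputable def cnpKernel {Ω : Type*} {d : ℕ∞} (u : Ω → UnitBall d) (x y : Ω) : ℂ :=
  1 / (1 - ⟪(u y).1, (u x).1⟫_ℂ)

/-- The Drury-Arveson kernel `(z, w) ↦ (1 - z w^*)⁻¹` on `𝔹^d`. -/
noncomputable def druryArvesonKernel (d : ℕ∞) : UnitBall d → UnitBall d → ℂ :=
  cnpKernel id

section

variable {X : Type*} (H : Type*) [NormedAddCommGroup H] [InnerProductSpace ℂ H] [RKHS ℂ H X ℂ]

/-- `H` is the reproducing kernel Hilbert space `𝓗(k)` of scalar functions on `X` with kernel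
`k`. -/
def HasKernel [CompleteSpace H] (k : X → X → ℂ) : Prop :=
  ∀ x y : X, RKHS.kernel H x y 1 = k x y

/-- `φ` belongs to `Mult(H)`: multiplication by `φ` is a bounded operator from `H` to `H`. -/
def IsMultiplier (φ : X → ℂ) : Prop :=
  ∃ T : H →L[ℂ] H, ∀ (f : H) (x : X), T f x = φ x * f x

/-- `a` is an `H`-outer function: a multiplier of `H` such that `a H` is dense in `H`. -/
def IsOuter (a : X → ℂ) : Prop :=
  IsMultiplier H a ∧ Dense {g : H | ∃ f : H, ∀ x : X, g x = a x * f x}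

/-- The column with entries `c j` is a contractive multiplier: `f ↦ (c j * f)_j` is a contraction
from `H` into the Hilbert space direct sum `⨁_j H`. -/
def IsContractiveColumn {ι : Type*} (c : ι → X → ℂ) : Prop :=
  ∃ T : H →L[ℂ] lp (fun _ : ι => H) 2, ‖T‖ ≤ 1 ∧
    ∀ (f : H) (j : ι) (x : X), (T f j) x = c j x * f x

/-- The closed linear span in `H` of the kernel functions `k(·, w)`, `w ∈ E`. For `H = H²_d` this
is the space `𝓗_E`. -/
noncomputable def kernelSpan [CompleteSpace H] (E : Set X) : Submodule ℂ H :=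
  (Submodule.span ℂ ((fun w : X => RKHS.kerFun H w (1 : ℂ)) '' E)).topologicalClosure

instance [CompleteSpace H] (E : Set X) : CompleteSpace (kernelSpan H E) :=
  (Submodule.isClosed_topologicalClosure _).completeSpace_coe

/-- The closed span of the kernel functions at the points of `E` is regarded as a space of
functions on `E`, by restriction; an element that vanishes on `E` is zero. -/
noncomputable instance kernelSpanRKHS [CompleteSpace H] (E : Set X) :
    RKHS ℂ (kernelSpan H E) E ℂ where
  coeCLM := ContinuousLinearMap.pi fun w : E =>
    ((ContinuousLinearMap.proj (R := ℂ) (φ := fun _ : X => ℂ) w.1).comp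
      (RKHS.coeCLM ℂ : H →L[ℂ] X → ℂ)).comp (kernelSpan H E).subtypeL
  coeCLM_injective := by
    refine (injective_iff_map_eq_zero _).mpr fun f hf => ?_
    have h0 : ∀ w ∈ E, (f : H) w = 0 := fun w hw => congrFun hf ⟨w, hw⟩
    have h1 : (f : H) ∈ (Submodule.span ℂ
        ((fun w : X => RKHS.kerFun H w (1 : ℂ)) '' E))ᗮ := by
      rw [Submodule.mem_orthogonal]
      intro g hg
      induction hg using Submodule.span_induction with
      | mem g hg =>
        obtain ⟨w, hw, rfl⟩ := hg
        simp [h0 w hw]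
      | zero => simp
      | add g g' _ _ h h' => simp [inner_add_left, h, h']
      | smul c g _ h => simp [inner_smul_left, h]
    rw [← Submodule.orthogonal_closure] at h1
    exact Subtype.ext (inner_self_eq_zero.mp (h1 f f.2))

theorem kernelSpan_apply [CompleteSpace H] (E : Set X) (f : kernelSpan H E) (z : E) :
    f z = (f : H) z.1 := rfl

end

open scoped ComplexOrder in
/-- Entrywise powers of a Gram matrix are positive semidefinite. -/
theorem posSemidef_gram_pow {E Ω : Type*} [NormedAddCommGroup E] [InnerProductSpace ℂ E] (v : Ω → E) (n : ℕ)
    (s : Finset Ω) :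
    (Matrix.of fun i j : s => ⟪v i, v j⟫_ℂ ^ n).PosSemidef := by
  classical
  induction n with
  | zero =>
    have e : (Matrix.of fun i j : s => ⟪v i, v j⟫_ℂ ^ 0) = Matrix.gram ℂ (fun _ : s => (1 : ℂ)) := by
      ext i j; simp [Matrix.gram]
    rw [e]; exact Matrix.posSemidef_gram ℂ _
  | succ n ih =>
    have e : (Matrix.of fun i j : s => ⟪v i, v j⟫_ℂ ^ (n + 1)) =
        (Matrix.of fun i j : s => ⟪v i, v j⟫_ℂ ^ n).hadamard (Matrix.gram ℂ (fun i : s => v i)) := by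
      ext i j; simp [Matrix.gram, pow_succ]
    rw [e]; exact ih.hadamard (Matrix.posSemidef_gram ℂ _)

open scoped ComplexOrder in
/-- `cnpKernel u` is a positive kernel: the space `𝓗(k)` exists. -/
theorem exists_hasKernel.{v} {Ω : Type v} {d : ℕ∞} (u : Ω → UnitBall d) :
    ∃ (H : Type v) (_ : NormedAddCommGroup H) (_ : InnerProductSpace ℂ H) (_ : CompleteSpace H)
      (_ : RKHS ℂ H Ω ℂ), HasKernel H (cnpKernel u) := by
  classical
  let K : Matrix Ω Ω (ℂ →L[ℂ] ℂ) := Matrix.of fun x y =>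
    cnpKernel u x y • (1 : ℂ →L[ℂ] ℂ)
  have hlt : ∀ x y : Ω, ‖⟪(u x).1, (u y).1⟫_ℂ‖ < 1 := fun x y => by
    have h1 : ‖(u x).1‖ < 1 := mem_ball_zero_iff.mp (u x).2
    have h2 : ‖(u y).1‖ < 1 := mem_ball_zero_iff.mp (u y).2
    have := norm_inner_le_norm (𝕜 := ℂ) (u x).1 (u y).1
    nlinarith [norm_nonneg (u x).1, norm_nonneg (u y).1]
  have hstar : ∀ x y, star (cnpKernel u y x) = cnpKernel u x y := fun x y => by
    simp [cnpKernel]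
  have hK : K.PosSemidef := by
    have tf : K.PosSemidef ↔ _ := (RKHS.posSemidef_tfae (K := K)).out 0 2
    refine tf.mpr ⟨?_, fun w => ?_⟩
    · ext x y
      simp [K, Matrix.conjTranspose_apply, ← hstar x y]
    · have key : ∀ n : ℕ, 0 ≤ Complex.re (∑ x ∈ w.support, ∑ y ∈ w.support,
          ⟪(u y).1, (u x).1⟫_ℂ ^ n * (w y * star (w x))) := by
        intro n
        have h := (posSemidef_gram_pow (fun x => (u x).1) n w.support).dotProduct_mulVec_nonneg
          (fun i => star (w i))
        have h2 := (Complex.nonneg_iff.mp h).1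
        convert h2 using 2
        rw [Finset.sum_comm, ← Finset.sum_coe_sort]
        simp only [dotProduct, Matrix.mulVec, Finset.mul_sum]
        refine Finset.sum_congr rfl fun x _ => ?_
        rw [← Finset.sum_coe_sort]
        refine Finset.sum_congr rfl fun y _ => ?_
        simp only [Matrix.of_apply, Pi.star_apply, star_star]; ring_nf; try rfl
      have hs : HasSum (fun n : ℕ => Complex.re (∑ x ∈ w.support, ∑ y ∈ w.support,
          ⟪(u y).1, (u x).1⟫_ℂ ^ n * (w y * star (w x))))
          (Complex.re (w.sum fun x v => w.sum fun x' v' => ⟪K x' x v, v'⟫_ℂ)) := by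
        refine Complex.hasSum_re ?_
        refine hasSum_sum fun x _ => hasSum_sum fun y _ => ?_
        have e : ⟪K y x (w x), w y⟫_ℂ = (1 - ⟪(u y).1, (u x).1⟫_ℂ)⁻¹ * (w y * star (w x)) := by
          change inner ℂ ((cnpKernel u y x • (1 : ℂ →L[ℂ] ℂ)) (w x)) (w y) = _
          simp [cnpKernel]
          ring
        have := (hasSum_geometric_of_norm_lt_one (hlt y x)).mul_right (w y * star (w x))
        rw [← e] at this
        exact this
      exact hs.nonneg key
  have : Fact K.PosSemidef := ⟨hK⟩
  refine ⟨RKHS.OfKernel K, inferInstance, inferInstance, inferInstance, inferInstance, ?_⟩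
  intro x y
  rw [RKHS.OfKernel.kernel_ofKernel]
  change (cnpKernel u x y • (1 : ℂ →L[ℂ] ℂ)) 1 = _
  simp

/-! The kernel $1/(1-u(x)u(y)^*)$ is the Gram matrix of the vectors `fockKernel (u x)` in the full
Fock space on words. Hence $\mathcal H(k)$ embeds there isometrically (`exists_fockLift`), and the
adjoint of the embedding $J$ turns a Fock vector $f$ into the function $x\mapsto\langle f,$
`fockKernel (u x)` $\rangle$.

Put the vacuum $\delta_\emptyset$ on top of the lifted $h_i$. This column $v$ has
$\|v\|^2=1+\sum\|h_i\|^2$. A noncommutative Beurling argument (`exists_wandering_isometry`,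
`exists_fock_factorization`) gives $v=\Theta g$, with $\Theta$ an isometric column commuting with
the creation operators. Such operators become multiplications after evaluation
(`fockKernel_inner_of_map_single`), so the components of $\Theta$ give functions $a,b_i$, and
$v=\Theta g$ reads $ag=1$, $b_ig=h_i$. Thus $g$ represents $1/a$, with $\|g\|=\|v\|$, and
compressing $\Theta$ to $\mathcal H(k)$ gives a contractive column. The function $a$ is outer
because the top component of $\Theta$ has every $\delta_w$ in its range.

Part (2) is a compression too: the orthogonal projection onto $\mathcal H_E$ is restriction to $E$
(`IsOuter.kernelSpan`). -/

section L2

open Classical in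
/-- The unit vector of `ℓ²(α)` at `w`. -/
noncomputable def l2Single {α : Type*} (w : α) : ℓ²(α, ℂ) := lp.single 2 w (1 : ℂ)

theorem l2Single_apply {α : Type*} [DecidableEq α] (v w : α) :
    l2Single v w = if v = w then 1 else 0 := by
  classical
  by_cases h : v = w
  · subst h; simp [l2Single]
  · simp [l2Single, h, Ne.symm h]

theorem l2Single_inner {α : Type*} (w : α) (f : ℓ²(α, ℂ)) : ⟪l2Single w, f⟫_ℂ = f w := by
  classical
  rw [l2Single, lp.inner_single_left]; simp

theorem orthonormal_l2Single (α : Type*) : Orthonormal ℂ (l2Single (α := α)) := by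
  classical
  rw [orthonormal_iff_ite]
  intro v w
  rw [l2Single_inner, l2Single_apply]
  simp [eq_comm]

/-- Continuous linear maps on `ℓ²(α)` that agree on the unit vectors are equal. -/
theorem l2_clm_ext {α F : Type*} [NormedAddCommGroup F] [NormedSpace ℂ F]
    {T T' : ℓ²(α, ℂ) →L[ℂ] F} (h : ∀ w, T (l2Single w) = T' (l2Single w)) : T = T' := by
  classical
  refine lp.ext_continuousLinearMap ENNReal.ofNat_ne_top fun w => ?_
  ext
  convert h w using 2 <;> simp [l2Single]

end L2

/-! ### Wandering vectors and Beurling factorization for row isometries. -/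

section Beurling

variable {I K : Type*} [NormedAddCommGroup K] [InnerProductSpace ℂ K] [CompleteSpace K]

/-- An orthonormal family indexed by `α` gives an isometry from `ℓ²(α)`. -/
theorem Orthonormal.exists_linearIsometry {α : Type*} {e : α → K}
    (he : Orthonormal ℂ e) :
    ∃ Θ : ℓ²(α, ℂ) →ₗᵢ[ℂ] K, (∀ w, Θ (l2Single w) = e w) ∧
      ∀ v ∈ (Submodule.span ℂ (Set.range e)).topologicalClosure, ∃ g, Θ g = v := by
  refine ⟨he.orthogonalFamily.linearIsometry, fun w => ?_, fun v hv => ?_⟩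
  · classical
    rw [l2Single, he.orthogonalFamily.linearIsometry_apply_single]
    simp
  · have h : v ∈ LinearMap.range he.orthogonalFamily.linearIsometry.toLinearMap := by
      rw [he.orthogonalFamily.range_linearIsometry]
      refine Submodule.topologicalClosure_mono (Submodule.span_le.mpr ?_) hv
      rintro _ ⟨w, rfl⟩
      exact Submodule.mem_iSup_of_mem w ⟨1, by simp⟩
    exact h

/-- A continuous linear map sends the closed span of `s` into a closed subspace as soon as it
sends `s` there. -/
theorem map_mem_of_mem_closure_span {K K' : Type*} [NormedAddCommGroup K] [NormedSpace ℂ K]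
    [NormedAddCommGroup K'] [NormedSpace ℂ K'] {s : Set K}
    {p : Submodule ℂ K'} (hp : IsClosed (p : Set K')) (T : K →L[ℂ] K')
    (h : ∀ x ∈ s, T x ∈ p) {x : K} (hx : x ∈ (Submodule.span ℂ s).topologicalClosure) :
    T x ∈ p := by
  have h1 : (Submodule.span ℂ s).topologicalClosure ≤ p.comap T.toLinearMap :=
    Submodule.topologicalClosure_minimal _ (Submodule.span_le.mpr h) (hp.preimage T.continuous)
  exact h1 hx

variable (S B : I → K →L[ℂ] K)

/-- Inner-outer factorization of a vector with respect to a pure row isometry `S` with adjoint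
column `B`. The functionals `L` vanish on the range of `S`, and purity says that `0` is the only
vector of a `B`-invariant set on which they all vanish. -/
theorem exists_wandering_isometry {κ : Type*}
    (hadj : ∀ i x y, ⟪S i x, y⟫_ℂ = ⟪x, B i y⟫_ℂ)
    (hBS : ∀ i x, B i (S i x) = x) (hBS' : ∀ i j, i ≠ j → ∀ x, B i (S j x) = 0)
    (L : κ → K →L[ℂ] ℂ) (hL : ∀ k i x, L k (S i x) = 0)
    (hpure : ∀ Q : Set K, (∀ q ∈ Q, (∀ k, L k q = 0) ∧ ∀ i, B i q ∈ Q) → ∀ q ∈ Q, q = 0)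
    {v : K} {k : κ} (hv : L k v ≠ 0) :
    ∃ (e : K) (Θ : ℓ²(List I, ℂ) →ₗᵢ[ℂ] K),
      (∀ w, Θ (l2Single w) = (w.map S).prod e) ∧ ∃ g, Θ g = v := by
  set W : List I → K →L[ℂ] K := fun w => (w.map S).prod with hW
  have hW0 : ∀ x, W [] x = x := fun x => by simp [hW]
  have hWc : ∀ i w x, W (i :: w) x = S i (W w x) := fun i w x => by simp [hW]
  have hWa : ∀ w w' x, W w (W w' x) = W (w ++ w') x := fun w w' x => by simp [hW]
  set N := (Submodule.span ℂ ((fun w => W w v) '' {w | w ≠ []})).topologicalClosure with hN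
  set M := (Submodule.span ℂ (Set.range fun w => W w v)).topologicalClosure with hM
  have hNc : IsClosed (N : Set K) := Submodule.isClosed_topologicalClosure _
  have hMc : IsClosed (M : Set K) := Submodule.isClosed_topologicalClosure _
  have : CompleteSpace N := hNc.completeSpace_coe
  have hWN : ∀ w, w ≠ [] → W w v ∈ N := fun w hw =>
    Submodule.le_topologicalClosure _ (Submodule.subset_span ⟨w, hw, rfl⟩)
  have hWM : ∀ w, W w v ∈ M := fun w =>
    Submodule.le_topologicalClosure _ (Submodule.subset_span ⟨w, rfl⟩)
  have hNM : N ≤ M := Submodule.topologicalClosure_mono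
    (Submodule.span_mono (Set.image_subset_range _ _))
  have hMN : ∀ w, w ≠ [] → ∀ x ∈ M, W w x ∈ N := fun w hw x hx =>
    map_mem_of_mem_closure_span hNc (W w) (by
      rintro _ ⟨w', rfl⟩
      simp only [hWa]
      exact hWN _ (by simp [hw])) hx
  have hBN : ∀ i, ∀ x ∈ N, B i x ∈ M := fun i x hx =>
    map_mem_of_mem_closure_span hMc (B i) (by
      rintro _ ⟨w, hw, rfl⟩
      obtain ⟨j, w, rfl⟩ := List.exists_cons_of_ne_nil hw
      simp only [hWc]
      by_cases hij : i = j
      · subst hij; rw [hBS]; exact hWM w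
      · rw [hBS' i j hij]; exact zero_mem _) hx
  have hLN : ∀ k, ∀ x ∈ N, L k x = 0 := fun k x hx => by
    have := map_mem_of_mem_closure_span (p := (⊥ : Submodule ℂ ℂ)) (by simp) (L k) (by
      rintro _ ⟨w, hw, rfl⟩
      obtain ⟨j, w, rfl⟩ := List.exists_cons_of_ne_nil hw
      simp [hWc, hL]) hx
    simpa using this
  set f : K := v - N.starProjection v with hf
  have hfv : v - f ∈ N := by simp [hf]
  have hfN : ∀ x ∈ N, ⟪f, x⟫_ℂ = 0 := fun x hx =>
    Submodule.starProjection_inner_eq_zero v x hx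
  -- Every `L k` kills `N`, and some `L k` does not kill `v`, so `v ∉ N`.
  have hf0 : f ≠ 0 := fun h => hv (hLN k v (by simpa [h] using hfv))
  have hfM : f ∈ M := by
    have := M.sub_mem (hWM []) (hNM hfv)
    simpa [hW0] using this
  -- `M ⊖ N` is the line through `f`: the projection `T` along `f` sends each generator of `M` into
  -- `N` and fixes `q`.
  have hmem : ∀ q ∈ M, ⟪f, q⟫_ℂ = 0 → q ∈ N := by
    intro q hq hfq
    let T : K →L[ℂ] K := ContinuousLinearMap.id ℂ K -
      ((⟪f, f⟫_ℂ)⁻¹ • innerSL ℂ f).smulRight f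
    have hT : ∀ x, T x = x - ((⟪f, f⟫_ℂ)⁻¹ * ⟪f, x⟫_ℂ) • f := fun x => by simp [T]
    have hff : ⟪f, f⟫_ℂ ≠ 0 := inner_self_ne_zero.mpr hf0
    have := map_mem_of_mem_closure_span hNc T (by
      rintro _ ⟨w, rfl⟩
      simp only [hT]
      by_cases hw : w = []
      · subst hw
        have : ⟪f, v⟫_ℂ = ⟪f, f⟫_ℂ := by
          have := hfN _ hfv
          rw [inner_sub_right, sub_eq_zero] at this
          exact this
        rw [hW0, this, inv_mul_cancel₀ hff, one_smul]
        exact hfv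
      · rw [hfN _ (hWN w hw)]
        simpa using hWN w hw) hq
    rw [hT, hfq] at this
    simpa using this
  -- Common prefixes cancel. What remains is either two different first letters, whose ranges are
  -- orthogonal, or `f` against an element of `N`.
  have horth : ∀ w w', w ≠ w' → ⟪W w f, W w' f⟫_ℂ = 0 := by
    intro w
    induction w with
    | nil =>
      intro w' hw
      rw [hW0]
      exact hfN _ (hMN w' (Ne.symm hw) f hfM)
    | cons i t ih =>
      intro w' hw
      cases w' with
      | nil =>
        rw [hW0, inner_eq_zero_symm]
        exact hfN _ (hMN _ hw f hfM)
      | cons j t' =>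
        rw [hWc, hWc, hadj]
        by_cases hij : i = j
        · subst hij
          rw [hBS]
          exact ih _ (fun h => hw (by rw [h]))
        · rw [hBS' i j hij, inner_zero_right]
  have hnorm : ∀ w x, ‖W w x‖ = ‖x‖ := by
    intro w x
    induction w with
    | nil => rw [hW0]
    | cons i t ih =>
      rw [hWc, ← ih, @norm_eq_sqrt_re_inner ℂ, @norm_eq_sqrt_re_inner ℂ _ _ _ _ (W t x), hadj, hBS]
  set e : K := ((‖f‖ : ℂ)⁻¹) • f with he
  have hon : Orthonormal ℂ (fun w => W w e) := by
    refine ⟨fun w => ?_, fun w w' hw => ?_⟩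
    · rw [hnorm, he, norm_smul]
      simp [hf0]
    · simp [he, inner_smul_left, inner_smul_right, horth w w' hw]
  obtain ⟨Θ, hΘ, hr⟩ := hon.exists_linearIsometry
  refine ⟨e, Θ, hΘ, hr v ?_⟩
  set R := (Submodule.span ℂ (Set.range fun w => W w e)).topologicalClosure with hR
  have hRc : IsClosed (R : Set K) := Submodule.isClosed_topologicalClosure _
  have : CompleteSpace R := hRc.completeSpace_coe
  have hWR : ∀ w, W w f ∈ R := fun w => by
    have h1 : W w e ∈ R := Submodule.le_topologicalClosure _ (Submodule.subset_span ⟨w, rfl⟩)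
    have h2 : W w f = (‖f‖ : ℂ) • W w e := by
      rw [he, map_smul, smul_smul, mul_inv_cancel₀ (by simpa using hf0), one_smul]
    rw [h2]; exact R.smul_mem _ h1
  have hRM : R ≤ M := Submodule.topologicalClosure_minimal _ (Submodule.span_le.mpr (by
    rintro _ ⟨w, rfl⟩
    simp only [he, map_smul]
    refine M.smul_mem _ ?_
    by_cases hw : w = []
    · rw [hw, hW0]; exact hfM
    · exact hNM (hMN w hw f hfM))) hMc
  -- This set is `M ⊖ R`. The empty word puts it inside `N`, hence the `L k` vanish on it and each
  -- `B i` maps it into `M`; moving `B i` across the inner product keeps the orthogonality. Purity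
  -- then makes it zero.
  have hq := hpure {q | q ∈ M ∧ ∀ w, ⟪W w f, q⟫_ℂ = 0} (by
    rintro q ⟨hqM, hq⟩
    have hqN : q ∈ N := hmem q hqM (by simpa [hW0] using hq [])
    refine ⟨fun k => hLN k q hqN, fun i => ⟨hBN i q hqN, fun w => ?_⟩⟩
    rw [← hadj, ← hWc]; exact hq _) (v - R.starProjection v) ⟨M.sub_mem (by
      simpa [hW0] using hWM []) (hRM (Submodule.starProjection_apply_mem R v)), fun w =>
      inner_eq_zero_symm.mp (Submodule.starProjection_inner_eq_zero v _ (hWR w))⟩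
  rw [sub_eq_zero] at hq
  rw [hq]
  exact Submodule.starProjection_apply_mem R v

end Beurling

/-! ### Creation and annihilation operators on the full Fock space. -/

section Fock

variable {I : Type*}

theorem exists_fockShift (i : I) : ∃ S : ℓ²(List I, ℂ) →ₗᵢ[ℂ] ℓ²(List I, ℂ),
    ∀ w, S (l2Single w) = l2Single (i :: w) :=
  let ⟨S, hS, _⟩ := ((orthonormal_l2Single (List I)).comp (fun w => i :: w)
    (List.cons_injective)).exists_linearIsometry
  ⟨S, hS⟩

/-- The creation operator `δ_w ↦ δ_{iw}` on the full Fock space `ℓ²(List I)`. -/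
noncomputable def fockShift (i : I) : ℓ²(List I, ℂ) →L[ℂ] ℓ²(List I, ℂ) :=
  (exists_fockShift i).choose.toContinuousLinearMap

/-- The annihilation operator, adjoint to `fockShift i`. -/
noncomputable def fockBackshift (i : I) : ℓ²(List I, ℂ) →L[ℂ] ℓ²(List I, ℂ) :=
  (fockShift i).adjoint

theorem norm_fockShift_le (i : I) : ‖fockShift i‖ ≤ 1 :=
  LinearIsometry.norm_toContinuousLinearMap_le _

theorem norm_fockBackshift_le (i : I) : ‖fockBackshift i‖ ≤ 1 := by
  rw [fockBackshift, LinearIsometryEquiv.norm_map]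
  exact norm_fockShift_le i

theorem fockShift_single (i : I) (w : List I) :
    fockShift i (l2Single w) = l2Single (i :: w) :=
  (exists_fockShift i).choose_spec w

theorem fockBackshift_apply (i : I) (f : ℓ²(List I, ℂ)) (w : List I) :
    fockBackshift i f w = f (i :: w) := by
  rw [← l2Single_inner, fockBackshift, ContinuousLinearMap.adjoint_inner_right, fockShift_single,
    l2Single_inner]

theorem fockBackshift_fockShift (i : I) (f : ℓ²(List I, ℂ)) :
    fockBackshift i (fockShift i f) = f := by
  classical
  have : (fockBackshift i).comp (fockShift i) = ContinuousLinearMap.id ℂ _ :=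
    l2_clm_ext fun w => by
      ext v
      simp [fockShift_single, fockBackshift_apply, l2Single_apply]
  exact DFunLike.congr_fun this f

theorem fockBackshift_fockShift_of_ne {i j : I} (h : i ≠ j) (f : ℓ²(List I, ℂ)) :
    fockBackshift i (fockShift j f) = 0 := by
  classical
  have : (fockBackshift i).comp (fockShift j) = 0 :=
    l2_clm_ext fun w => by
      ext v
      simp [fockShift_single, fockBackshift_apply, l2Single_apply, h.symm]
  exact DFunLike.congr_fun this f

theorem fockShift_apply_nil (i : I) (f : ℓ²(List I, ℂ)) : fockShift i f [] = 0 := by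
  classical
  have : (lp.evalCLM ℂ (fun _ : List I => ℂ) 2 []).comp (fockShift i) = 0 :=
    l2_clm_ext fun w => by simp [fockShift_single, lp.evalCLM, l2Single_apply]
  exact DFunLike.congr_fun this f

/-- Factorization of a square summable column over the full Fock space with a component that does
not vanish at the empty word: `v = Θ g` with `Θ` an isometric column commuting with the shifts. -/
theorem exists_fock_factorization {ι : Type*} (v : lp (fun _ : ι => ℓ²(List I, ℂ)) 2) {k : ι}
    (hv : v k [] ≠ 0) :
    ∃ (e : lp (fun _ : ι => ℓ²(List I, ℂ)) 2)
      (Θ : ℓ²(List I, ℂ) →ₗᵢ[ℂ] lp (fun _ : ι => ℓ²(List I, ℂ)) 2),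
      (∀ w j, Θ (l2Single w) j = (w.map fockShift).prod (e j)) ∧ ∃ g, Θ g = v := by
  let S : I → lp (fun _ : ι => ℓ²(List I, ℂ)) 2 →L[ℂ] lp (fun _ : ι => ℓ²(List I, ℂ)) 2 :=
    fun i => lp.mapCLM 2 (fun _ => fockShift i) zero_le_one fun _ => norm_fockShift_le i
  let B : I → lp (fun _ : ι => ℓ²(List I, ℂ)) 2 →L[ℂ] lp (fun _ : ι => ℓ²(List I, ℂ)) 2 :=
    fun i => lp.mapCLM 2 (fun _ => fockBackshift i) zero_le_one fun _ => norm_fockBackshift_le i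
  have hS : ∀ i x j, S i x j = fockShift i (x j) := fun i x j => rfl
  have hB : ∀ i x j, B i x j = fockBackshift i (x j) := fun i x j => rfl
  obtain ⟨e, Θ, hΘ, g, hg⟩ := exists_wandering_isometry S B (v := v) (k := k)
    (fun i x y => by
      simp only [lp.inner_eq_tsum, hS, hB, fockBackshift, ContinuousLinearMap.adjoint_inner_right])
    (fun i x => by ext1; ext1 j; simp only [hS, hB, fockBackshift_fockShift])
    (fun i j hij x => by
      ext1; ext1 k; simp only [hS, hB, fockBackshift_fockShift_of_ne hij]; rfl)
    (fun k => (lp.evalCLM ℂ (fun _ : List I => ℂ) 2 []).comp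
      (lp.evalCLM ℂ (fun _ : ι => ℓ²(List I, ℂ)) 2 k))
    (fun k i x => fockShift_apply_nil i (x k))
    -- Annihilation strips the first letter, so every coefficient of `q` is a vacuum coefficient of
    -- some element of `Q`.
    (fun Q hQ q hq => by
      have key : ∀ w : List I, ∀ q ∈ Q, ∀ j, q j w = 0 := by
        intro w
        induction w with
        | nil => exact fun q hq j => (hQ q hq).1 j
        | cons i w ih =>
          intro q hq j
          have := ih _ ((hQ q hq).2 i) j
          rwa [hB, fockBackshift_apply] at this
      ext1; ext1 j; ext1; ext1 w
      exact key w q hq j)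
    hv
  refine ⟨e, Θ, fun w j => ?_, g, hg⟩
  rw [hΘ]
  clear hΘ
  induction w with
  | nil => simp
  | cons i w ih =>
    simp only [List.map_cons, List.prod_cons, mul_apply_eq_comp, hS]
    rw [ih]

end Fock

/-! ### Geometric series over words. -/

section Words

variable {I : Type*}

theorem injective_uncurry_cons : Function.Injective (fun p : I × List I => p.1 :: p.2) := by
  rintro ⟨i, v⟩ ⟨j, w⟩ h
  simpa using h

/-- Sums over words of multiplicative weights: absolute convergence. -/
theorem summable_list_prod {f : I → ℝ} (hf0 : ∀ i, 0 ≤ f i) (hf : Summable f)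
    (h1 : ∑' i, f i < 1) : Summable fun w : List I => (w.map f).prod := by
  classical
  set r := ∑' i, f i with hr
  have hr0 : 0 < 1 - r := sub_pos.mpr h1
  have hp0 : ∀ w : List I, 0 ≤ (w.map f).prod := fun w =>
    List.prod_nonneg (by simpa using fun i _ => hf0 i)
  -- The bound reproduces itself when the first letter is split off: $1+r(1-r)^{-1}=(1-r)^{-1}$.
  have key : ∀ (n : ℕ) (s : Finset (List I)), (∀ w ∈ s, w.length < n) →
      ∑ w ∈ s, (w.map f).prod ≤ (1 - r)⁻¹ := by
    intro n
    induction n with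
    | zero =>
      intro s hs
      have : s = ∅ := Finset.eq_empty_of_forall_notMem fun w hw => by simpa using hs w hw
      simpa [this] using hr0.le
    | succ n ih =>
      intro s hs
      set A : Finset I := s.biUnion fun w => w.toFinset with hA
      set t : Finset (List I) := (s.erase []).image List.tail with ht
      have hst : s ⊆ insert [] ((A ×ˢ t).image fun p => p.1 :: p.2) := by
        intro w hw
        cases w with
        | nil => simp
        | cons i w =>
          refine Finset.mem_insert_of_mem (Finset.mem_image.mpr ⟨(i, w), ?_, rfl⟩)
          refine Finset.mem_product.mpr ⟨Finset.mem_biUnion.mpr ⟨_, hw, by simp⟩,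
            Finset.mem_image.mpr ⟨i :: w, by simp [hw], rfl⟩⟩
      have hlen : ∀ w ∈ t, w.length < n := by
        intro w hw
        obtain ⟨v, hv, rfl⟩ := Finset.mem_image.mp hw
        obtain ⟨hv0, hv⟩ := Finset.mem_erase.mp hv
        obtain ⟨i, v, rfl⟩ := List.exists_cons_of_ne_nil hv0
        simpa using hs _ hv
      have hAr : ∑ i ∈ A, f i ≤ r := hf.sum_le_tsum A fun i _ => hf0 i
      calc ∑ w ∈ s, (w.map f).prod
          ≤ ∑ w ∈ insert [] ((A ×ˢ t).image fun p => p.1 :: p.2), (w.map f).prod :=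
            Finset.sum_le_sum_of_subset_of_nonneg hst fun w _ _ => hp0 w
        _ = 1 + (∑ i ∈ A, f i) * ∑ w ∈ t, (w.map f).prod := by
            rw [Finset.sum_insert (by simp), Finset.sum_image injective_uncurry_cons.injOn,
              Finset.sum_mul_sum, ← Finset.sum_product']
            simp
        _ ≤ 1 + r * (1 - r)⁻¹ := by
            gcongr
            · exact Finset.sum_nonneg fun w _ => hp0 w
            · exact tsum_nonneg hf0
            · exact ih t hlen
        _ = (1 - r)⁻¹ := by field_simp; ring
  refine summable_of_sum_le hp0 (c := (1 - r)⁻¹) fun s => ?_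
  exact key (s.sup List.length + 1) s fun w hw => Nat.lt_succ_of_le (Finset.le_sup hw)

/-- Sums over words of multiplicative weights: the value is that of a geometric series. -/
theorem tsum_list_prod {f : I → ℂ} (hf : Summable fun w : List I => (w.map f).prod)
    (h1 : ∑' i, f i ≠ 1) : ∑' w : List I, (w.map f).prod = 1 / (1 - ∑' i, f i) := by
  classical
  have hf1 : Summable f := by
    simpa [Function.comp_def] using hf.comp_injective (List.singleton_injective (α := I))
  have h2 := hf.comp_injective injective_uncurry_cons
  have h3 : ∑' p : I × List I, f p.1 * (p.2.map f).prod = (∑' i, f i) *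
      ∑' w : List I, (w.map f).prod :=
    (hf1.tsum_mul_tsum hf (by simpa [Function.comp_def] using h2)).symm
  have h4 : ∑' p : I × List I, f p.1 * (p.2.map f).prod =
      ∑' w : List I, if w = [] then 0 else (w.map f).prod := by
    rw [← injective_uncurry_cons.tsum_eq]
    · simp
    · intro w hw
      cases w with
      | nil => simp at hw
      | cons i w => exact ⟨(i, w), rfl⟩
  -- Splitting off the first letter gives $s=1+(\sum f_i)s$ for the sum $s$.
  have h5 := hf.tsum_eq_add_tsum_ite []
  rw [← h4, h3, List.map_nil, List.prod_nil] at h5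
  rw [eq_div_iff (sub_ne_zero.mpr h1.symm)]
  linear_combination h5

end Words

/-! ### Point evaluations on the Fock space. -/

section FockKernel

variable {I : Type*}

theorem norm_list_prod {f : I → ℂ} (w : List I) :
    ‖(w.map f).prod‖ = (w.map fun i => ‖f i‖).prod := by
  induction w with
  | nil => simp
  | cons i w ih => simp [ih]

theorem tsum_norm_sq {α : Type*} (x : ℓ²(α, ℂ)) :
    (Summable fun i => ‖x i‖ ^ 2) ∧ ∑' i, ‖x i‖ ^ 2 = ‖x‖ ^ 2 := by
  have h := lp.hasSum_norm (p := 2) (by norm_num) x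
  simp only [ENNReal.toReal_ofNat, Real.rpow_ofNat] at h
  exact ⟨h.summable, h.tsum_eq⟩

/-- The vector of the full Fock space that represents the evaluation at `x`, a point of the open
unit ball of `ℓ²(I)`. -/
noncomputable def fockKernel (x : Metric.ball (0 : ℓ²(I, ℂ)) 1) : ℓ²(List I, ℂ) :=
  ⟨fun w => (w.map fun i => conj (x.1 i)).prod, memℓp_gen (by
    have hx : ‖x.1‖ < 1 := mem_ball_zero_iff.mp x.2
    obtain ⟨h1, h2⟩ := tsum_norm_sq x.1
    convert summable_list_prod (f := fun i => ‖x.1 i‖ ^ 2) (fun i => by positivity) h1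
      (by rw [h2]; nlinarith [norm_nonneg x.1]) using 2 with w
    rw [norm_list_prod]
    induction w with
    | nil => simp
    | cons i w ih =>
      simp only [ENNReal.toReal_ofNat, Real.rpow_ofNat, RCLike.norm_conj] at ih
      simp [mul_pow, ih])⟩

theorem fockKernel_apply (x : Metric.ball (0 : ℓ²(I, ℂ)) 1) (w : List I) :
    fockKernel x w = (w.map fun i => conj (x.1 i)).prod := rfl

theorem fockKernel_inner_fockKernel (x y : Metric.ball (0 : ℓ²(I, ℂ)) 1) :
    ⟪fockKernel x, fockKernel y⟫_ℂ = 1 / (1 - ⟪y.1, x.1⟫_ℂ) := by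
  have h : ∀ w : List I, ⟪fockKernel x w, fockKernel y w⟫_ℂ =
      (w.map fun i => ⟪y.1 i, x.1 i⟫_ℂ).prod := by
    intro w
    simp only [fockKernel_apply]
    induction w with
    | nil => simp
    | cons i w ih =>
      simp only [RCLike.inner_apply] at ih
      simp only [List.map_cons, List.prod_cons, RCLike.inner_apply, map_mul, Complex.conj_conj,
        ← ih]
      ring
  have hs := lp.summable_inner (𝕜 := ℂ) (fockKernel x) (fockKernel y)
  simp only [h] at hs
  rw [lp.inner_eq_tsum, lp.inner_eq_tsum, tsum_congr h]
  refine tsum_list_prod hs fun h1 => ?_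
  rw [← lp.inner_eq_tsum] at h1
  have h2 := norm_inner_le_norm (𝕜 := ℂ) y.1 x.1
  have hx : ‖x.1‖ < 1 := mem_ball_zero_iff.mp x.2
  have hy : ‖y.1‖ < 1 := mem_ball_zero_iff.mp y.2
  rw [h1, norm_one] at h2
  nlinarith [norm_nonneg x.1, norm_nonneg y.1]

/-- Its coefficients are multiplicative in the word, so stripping a letter only costs a scalar.
Being a joint eigenvector of the adjoints is what turns shifts into coordinate multiplications. -/
theorem fockBackshift_fockKernel (i : I) (x : Metric.ball (0 : ℓ²(I, ℂ)) 1) :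
    fockBackshift i (fockKernel x) = conj (x.1 i) • fockKernel x := by
  ext1; ext1 w
  simp [fockBackshift_apply, fockKernel_apply]

theorem fockKernel_inner_single (x : Metric.ball (0 : ℓ²(I, ℂ)) 1) (w : List I) :
    ⟪fockKernel x, l2Single w⟫_ℂ = (w.map x.1).prod := by
  rw [← inner_conj_symm, l2Single_inner, fockKernel_apply, map_list_prod, List.map_map]
  simp [Function.comp_def]

theorem fockKernel_inner_prod (x : Metric.ball (0 : ℓ²(I, ℂ)) 1) (w : List I)
    (f : ℓ²(List I, ℂ)) :
    ⟪fockKernel x, (w.map fockShift).prod f⟫_ℂ = (w.map x.1).prod * ⟪fockKernel x, f⟫_ℂ := by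
  induction w with
  | nil => simp
  | cons i w ih =>
    rw [List.map_cons, List.prod_cons, mul_apply_eq_comp,
      ← ContinuousLinearMap.adjoint_inner_left, ← fockBackshift, fockBackshift_fockKernel,
      inner_smul_left, ih]
    simp [mul_assoc]

/-- Operators commuting with the shifts act on functions on the ball as multiplications. -/
theorem fockKernel_inner_of_map_single {T : ℓ²(List I, ℂ) →L[ℂ] ℓ²(List I, ℂ)}
    {e : ℓ²(List I, ℂ)} (hT : ∀ w, T (l2Single w) = (w.map fockShift).prod e)
    (x : Metric.ball (0 : ℓ²(I, ℂ)) 1) (f : ℓ²(List I, ℂ)) :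
    ⟪fockKernel x, T f⟫_ℂ = ⟪fockKernel x, e⟫_ℂ * ⟪fockKernel x, f⟫_ℂ := by
  have : (innerSL ℂ (fockKernel x)).comp T =
      ⟪fockKernel x, e⟫_ℂ • innerSL ℂ (fockKernel x) := l2_clm_ext fun w => by
    simp only [ContinuousLinearMap.comp_apply, innerSL_apply_apply, hT, fockKernel_inner_prod,
      smul_apply, fockKernel_inner_single, smul_eq_mul]
    ring
  exact DFunLike.congr_fun this f

end FockKernel

/-! ### Transfer between the Fock space and $\mathcal H(k)$; the two assertions. -/

theorem hasSum_option {α : Type*} {f : Option α → ℝ} {s : ℝ} (h : HasSum (fun a => f (some a)) s) :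
    HasSum f (f none + s) := by
  classical
  have h1 : HasSum (fun o : Option α => o.elim 0 fun a => f (some a)) s := by
    rw [← (Option.some_injective α).hasSum_iff]
    · exact h
    · rintro (_ | a) ha
      · rfl
      · exact absurd ⟨a, rfl⟩ ha
  convert! (hasSum_ite_eq (none : Option α) (f none)).add h1 using 1
  ext (_ | a) <;> simp

/-- Two families with the same Gram matrix are related by a linear isometry, if the span of the
first one is dense. -/
theorem exists_linearIsometry_of_inner_eq {X H F : Type*} [NormedAddCommGroup H]
    [InnerProductSpace ℂ H] [NormedAddCommGroup F] [InnerProductSpace ℂ F] [CompleteSpace F]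
    (p : X → H) (q : X → F) (hpq : ∀ x y, ⟪p x, p y⟫_ℂ = ⟪q x, q y⟫_ℂ)
    (hd : (Submodule.span ℂ (Set.range p)).topologicalClosure = ⊤) :
    ∃ J : H →ₗᵢ[ℂ] F, ∀ x, J (p x) = q x := by
  set e := Finsupp.linearCombination ℂ p
  set f := Finsupp.linearCombination ℂ q
  have hnorm : ∀ c, ‖f c‖ = ‖e c‖ := fun c => by
    rw [@norm_eq_sqrt_re_inner ℂ, @norm_eq_sqrt_re_inner ℂ]
    simp only [e, f, Finsupp.linearCombination_apply, Finsupp.sum_inner, Finsupp.inner_sum, hpq,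
      inner_smul_left, inner_smul_right]
  have hde : DenseRange e := by
    rw [← Finsupp.range_linearCombination] at hd
    exact Submodule.dense_iff_topologicalClosure_eq_top.mpr hd
  have hex : ∃ C : ℝ, ∀ c, ‖f c‖ ≤ C * ‖e c‖ := ⟨1, fun c => by rw [hnorm, one_mul]⟩
  have heq : ∀ c, f.extendOfNorm e (e c) = f c := LinearMap.extendOfNorm_eq hde hex
  refine ⟨⟨f.extendOfNorm e, fun x => ?_⟩, fun x => ?_⟩
  · refine hde.induction_on (p := fun x => ‖f.extendOfNorm e x‖ = ‖x‖) x
      (isClosed_eq (by fun_prop) (by fun_prop)) fun c => ?_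
    rw [heq, hnorm]
  · have := heq (Finsupp.single x 1)
    simpa [e, f] using this

section

variable {Ω I : Type*} {H : Type*} [NormedAddCommGroup H] [InnerProductSpace ℂ H] [CompleteSpace H]
  [RKHS ℂ H Ω ℂ]

theorem kerFun_one_inner (x : Ω) (f : H) : ⟪RKHS.kerFun H x (1 : ℂ), f⟫_ℂ = f x := by
  simp

/-- The isometric embedding of `𝓗(k)` into the full Fock space. -/
theorem exists_fockLift {u : Ω → Metric.ball (0 : ℓ²(I, ℂ)) 1}
    (hk : HasKernel H fun x y => 1 / (1 - ⟪(u y).1, (u x).1⟫_ℂ)) :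
    ∃ J : H →ₗᵢ[ℂ] ℓ²(List I, ℂ), ∀ x, J (RKHS.kerFun H x (1 : ℂ)) = fockKernel (u x) := by
  refine exists_linearIsometry_of_inner_eq _ _ (fun x y => ?_) ?_
  · rw [kerFun_one_inner, RKHS.kerFun_apply, hk, fockKernel_inner_fockKernel]
  · rw [eq_top_iff, ← RKHS.kerFun_dense H]
    refine Submodule.topologicalClosure_mono (Submodule.span_le.mpr ?_)
    rintro _ ⟨x, c, rfl⟩
    have : RKHS.kerFun H x c = c • RKHS.kerFun H x (1 : ℂ) := by
      rw [← map_smul, smul_eq_mul, mul_one]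
    rw [this]
    exact Submodule.smul_mem _ _ (Submodule.subset_span ⟨x, rfl⟩)

/-- Factorization `h = b / a` of a square summable sequence in a normalized complete
Nevanlinna-Pick space. -/
theorem exists_outer_factorization {u : Ω → Metric.ball (0 : ℓ²(I, ℂ)) 1}
    (hk : HasKernel H fun x y => 1 / (1 - ⟪(u y).1, (u x).1⟫_ℂ))
    {h : ℕ → H} (hh : Summable fun i => ‖h i‖ ^ 2) :
    ∃ (a : Ω → ℂ) (b : ℕ → Ω → ℂ),
      IsOuter H a ∧
      (∀ i, IsMultiplier H (b i)) ∧
      (∀ x, a x ≠ 0) ∧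
      (∀ i x, h i x = b i x / a x) ∧
      IsContractiveColumn H (fun j : Option ℕ => j.elim a b) ∧
      ∃ g : H, (∀ x, g x = 1 / a x) ∧ ‖g‖ ^ 2 ≤ 1 + ∑' i, ‖h i‖ ^ 2 := by
  obtain ⟨J, hJ⟩ := exists_fockLift hk
  have hJi : ∀ x (f : H), ⟪fockKernel (u x), J f⟫_ℂ = f x := fun x f => by
    rw [← hJ, J.inner_map_map, kerFun_one_inner]
  set R : ℓ²(List I, ℂ) →L[ℂ] H := J.toContinuousLinearMap.adjoint with hR
  have hRi : ∀ x f, R f x = ⟪fockKernel (u x), f⟫_ℂ := fun x f => by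
    rw [← kerFun_one_inner, hR, ContinuousLinearMap.adjoint_inner_right, ← hJ]; rfl
  have hR1 : ‖R‖ ≤ 1 := by
    rw [hR, LinearIsometryEquiv.norm_map]; exact J.norm_toContinuousLinearMap_le
  have hsum : HasSum (fun j : Option ℕ => ‖j.elim (l2Single ([] : List I)) (fun i => J (h i))‖ ^ 2)
      (1 + ∑' i, ‖h i‖ ^ 2) := by
    convert! hasSum_option (f := fun j : Option ℕ =>
      ‖j.elim (l2Single ([] : List I)) (fun i => J (h i))‖ ^ 2) (s := ∑' i, ‖h i‖ ^ 2)
      (by simpa using hh.hasSum) using 2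
    simp [(orthonormal_l2Single (List I)).1]
  let v : lp (fun _ : Option ℕ => ℓ²(List I, ℂ)) 2 :=
    -- The extra entry, the vacuum, represents the constant function 1. It forces $ag=1$ and
    -- accounts for the 1 in the norm bound.
    ⟨fun j => j.elim (l2Single []) (fun i => J (h i)), memℓp_gen (by simpa using hsum.summable)⟩
  have hv : ‖v‖ ^ 2 = 1 + ∑' i, ‖h i‖ ^ 2 := by
    have := lp.hasSum_norm (p := 2) (by norm_num) v
    simp only [ENNReal.toReal_ofNat, Real.rpow_ofNat] at this
    exact this.unique hsum
  obtain ⟨e, Θ, hΘ, g, hg⟩ := exists_fock_factorization v (k := none) (by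
    classical
    change l2Single [] [] ≠ (0 : ℂ)
    simp [l2Single_apply])
  let E : Option ℕ → ℓ²(List I, ℂ) →L[ℂ] ℓ²(List I, ℂ) := fun j =>
    (lp.evalCLM ℂ (fun _ : Option ℕ => ℓ²(List I, ℂ)) 2 j).comp Θ.toContinuousLinearMap
  have hE : ∀ j f, E j f = Θ f j := fun j f => rfl
  have hEm : ∀ j x f, ⟪fockKernel (u x), E j f⟫_ℂ =
      ⟪fockKernel (u x), e j⟫_ℂ * ⟪fockKernel (u x), f⟫_ℂ := fun j x f =>
    fockKernel_inner_of_map_single (fun w => by rw [hE, hΘ]) _ _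
  have hEg : ∀ j, E j g = v j := fun j => by rw [hE, hg]
  have hmult : ∀ j (f : H) x, R (E j (J f)) x = ⟪fockKernel (u x), e j⟫_ℂ * f x := fun j f x => by
    rw [hRi, hEm, hJi]
  have hagx : ∀ x, ⟪fockKernel (u x), e none⟫_ℂ * ⟪fockKernel (u x), g⟫_ℂ = 1 := fun x => by
    rw [← hEm, hEg]
    change ⟪fockKernel (u x), l2Single []⟫_ℂ = 1
    simp [fockKernel_inner_single]
  have hES : ∀ j (w : List I) f, E j ((w.map fockShift).prod f) = (w.map fockShift).prod (E j f) := by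
    intro j w f
    induction w with
    | nil => simp
    | cons i w ih =>
      have h1 : (E j).comp (fockShift i) = (fockShift i).comp (E j) := l2_clm_ext fun w => by
        simp only [ContinuousLinearMap.comp_apply, hE, fockShift_single, hΘ, List.map_cons,
          List.prod_cons, mul_apply_eq_comp]
      rw [List.map_cons, List.prod_cons, mul_apply_eq_comp, mul_apply_eq_comp, ← ih]
      exact DFunLike.congr_fun h1 _
  have hS1 : ∀ w : List I, (w.map fockShift).prod (l2Single []) = l2Single w := by
    intro w
    induction w with
    | nil => simp
    | cons i w ih => rw [List.map_cons, List.prod_cons, mul_apply_eq_comp, ih, fockShift_single]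
  refine ⟨fun x => ⟪fockKernel (u x), e none⟫_ℂ, fun i x => ⟪fockKernel (u x), e (some i)⟫_ℂ,
    ⟨⟨(R.comp (E none)).comp J.toContinuousLinearMap, hmult none⟩, ?_⟩,
    fun i => ⟨(R.comp (E (some i))).comp J.toContinuousLinearMap, hmult (some i)⟩,
    fun x => left_ne_zero_of_mul_eq_one (hagx x), fun i x => ?_, ?_, R g, fun x => ?_, ?_⟩
  -- Applying `E none` to the shifts of `g` gives all unit vectors $\delta_w$, so a `q` orthogonal
  -- to the range has `J q = 0`.
  · have hd : (R.comp (E none)).range.topologicalClosure = ⊤ := by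
      rw [Submodule.topologicalClosure_eq_top_iff, Submodule.eq_bot_iff]
      intro q hq
      rw [Submodule.mem_orthogonal] at hq
      refine (map_eq_zero_iff J J.injective).mp ?_
      ext1; ext1 w
      have h1 := hq (R (E none ((w.map fockShift).prod g))) ⟨_, rfl⟩
      rw [hES, hEg, hR, ContinuousLinearMap.adjoint_inner_left] at h1
      change ⟪(w.map fockShift).prod (l2Single []), J q⟫_ℂ = 0 at h1
      rwa [hS1, l2Single_inner] at h1
    refine (Submodule.dense_iff_topologicalClosure_eq_top.mpr hd).mono ?_
    rintro _ ⟨f, rfl⟩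
    -- `f` need not lie in the range of `J`, but evaluation sees only `R f`, so `R (E none f)` is
    -- still `a` times an element of `H`.
    refine ⟨R f, fun x => ?_⟩
    change R (E none f) x = _
    rw [hRi, hRi, hEm]
  · rw [eq_div_iff (left_ne_zero_of_mul_eq_one (hagx x))]
    have h1 : h i x = ⟪fockKernel (u x), e (some i)⟫_ℂ * ⟪fockKernel (u x), g⟫_ℂ := by
      rw [← hEm, hEg]
      exact (hJi x (h i)).symm
    rw [h1, mul_assoc, mul_comm _ (⟪fockKernel (u x), e none⟫_ℂ), hagx, mul_one]
  · let P := lp.mapCLM 2 (fun _ : Option ℕ => R) zero_le_one fun _ => hR1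
    refine ⟨(P.comp Θ.toContinuousLinearMap).comp J.toContinuousLinearMap, ?_, fun f j x => ?_⟩
    · refine ContinuousLinearMap.opNorm_le_bound _ zero_le_one fun f => ?_
      calc ‖P (Θ (J f))‖ ≤ 1 * ‖Θ (J f)‖ :=
            P.le_of_opNorm_le (lp.norm_mapCLM_le 2 _ zero_le_one _) _
        _ = 1 * ‖f‖ := by rw [Θ.norm_map, J.norm_map]
    · have h1 := hmult j f x
      cases j <;> exact h1
  · rw [hRi, eq_div_iff (left_ne_zero_of_mul_eq_one (hagx x)), mul_comm, hagx]
  · rw [← hv, ← hg, Θ.norm_map]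
    gcongr
    simpa using R.le_of_opNorm_le hR1 g

/-- Outer multipliers restrict to outer multipliers of the closed span of kernel functions. -/
theorem IsOuter.kernelSpan {a : Ω → ℂ} (ha : IsOuter H a) (E : Set Ω) :
    IsOuter (kernelSpan H E) fun z : E => a z := by
  obtain ⟨⟨T, hT⟩, hd⟩ := ha
  set P : H →L[ℂ] _root_.kernelSpan H E := (_root_.kernelSpan H E).orthogonalProjectionOnto with hP
  -- Evaluation at a point of `E` pairs with a kernel function inside the subspace, so projecting
  -- does not change the value.
  have hPz : ∀ (f : H) (z : E), P f z = f z.1 := fun f z => by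
    rw [kernelSpan_apply, ← kerFun_one_inner, ← kerFun_one_inner z.1 f]
    have hz : RKHS.kerFun H z.1 (1 : ℂ) ∈ _root_.kernelSpan H E :=
      Submodule.le_topologicalClosure _ (Submodule.subset_span ⟨z.1, z.2, rfl⟩)
    exact Submodule.inner_orthogonalProjectionOnto_eq_of_mem_left ⟨_, hz⟩ f
  refine ⟨⟨(P.comp T).comp (_root_.kernelSpan H E).subtypeL, fun f z => ?_⟩, ?_⟩
  · change P (T f) z = _
    rw [hPz, hT, kernelSpan_apply]
  -- A continuous surjection maps the dense set `a H` to a dense set, which consists of products of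
  -- `a` with restrictions.
  · have hs : Function.Surjective P := fun f => ⟨f, by simp [hP]⟩
    refine (hs.denseRange.dense_image P.continuous hd).mono ?_
    rintro _ ⟨g, ⟨f, hf⟩, rfl⟩
    exact ⟨P f, fun z => by rw [hPz, hPz, hf]⟩

end

theorem mainTheorem5 {Ω : Type*} {d : ℕ∞} (u : Ω → UnitBall d) :
    (∀ (H : Type*) [NormedAddCommGroup H] [InnerProductSpace ℂ H] [CompleteSpace H]
        [RKHS ℂ H Ω ℂ], HasKernel H (cnpKernel u) →
      ∀ h : ℕ → H, Summable (fun i => ‖h i‖ ^ 2) →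
        ∃ (a : Ω → ℂ) (b : ℕ → Ω → ℂ),
          IsOuter H a ∧
          (∀ i, IsMultiplier H (b i)) ∧
          (∀ x, a x ≠ 0) ∧
          (∀ i x, h i x = b i x / a x) ∧
          IsContractiveColumn H (fun j : Option ℕ => j.elim a b) ∧
          ∃ g : H, (∀ x, g x = 1 / a x) ∧ ‖g‖ ^ 2 ≤ 1 + ∑' i, ‖h i‖ ^ 2) ∧
    (∀ (D : Type*) [NormedAddCommGroup D] [InnerProductSpace ℂ D] [CompleteSpace D]
        [RKHS ℂ D (UnitBall d) ℂ], HasKernel D (druryArvesonKernel d) →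
      ∀ a : UnitBall d → ℂ, IsOuter D a →
        IsOuter (kernelSpan D (Set.range u)) (fun z : Set.range u => a z)) :=
  ⟨fun _ _ _ _ _ hk _ hh => exists_outer_factorization hk hh,
    fun _ _ _ _ _ _ _ ha => ha.kernelSpan _⟩
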